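/- For an integer $k\ge 1$ let $\zeta(\overline{k})=\sum_{m\ge 1}\frac{(-1)^m}{m^k}$, for $k\ge 2$ let $\zeta(k)=\sum_{m\ge 1}\frac1{m^k}$, and put $\zeta(0)=\zeta(\overline{0})=-\tfrac12$. For integers $r,s\ge 1$ let $$\zeta(\overline{r},s)=\sum_{m=2}^{\infty}\frac{1}{m^s}\sum_{j=1}^{m-1}\frac{(-1)^j}{j^r}\ (s\ge 2),\qquad \zeta(r,\overline{s})=\sum_{m=2}^{\infty}\frac{(-1)^m}{m^s}\sum_{j=1}^{m-1}\frac{1}{j^r},\qquad \zeta(\overline{r},\overline{s})=\sum_{m=2}^{\infty}\frac{(-1)^m}{m^s}\sum_{j=1}^{m-1}\frac{(-1)^j}{j^r},$$ all series being limits of their partial sums. **Theorem.** Let $r,s\ge 1$ be integers such that $k=r+s\ge 3$ is odd. Then the following series converge and have the stated values, where a product $0\cdot\zeta(1)$ (the coefficient being a binomial coefficient $\binom{0}{n}$ with $n\geq 1$) is read as $0$. 1. If $s\ge 2$, then $$\zeta(\overline{r},s)=-\frac12\zeta(\overline{k})+\frac{1+(-1)^s}{2}\zeta(\overline{r})\zeta(s)+(-1)^r\sum_{l=0}^{\frac{k-1}{2}}\left[\binom{k-2l-1}{r-1}\zeta(\overline{k-2l})+\binom{k-2l-1}{s-1}\zeta(k-2l)\right]\zeta(\overline{2l}).$$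 2. If $r\ge 2$, then $$\zeta(r,\overline{s})=-\frac12\zeta(\overline{k})+\frac{1+(-1)^s}{2}\zeta(r)\zeta(\overline{s})+(-1)^r\sum_{l=0}^{\frac{k-1}{2}}\left[\binom{k-2l-1}{r-1}\zeta(k-2l)+\binom{k-2l-1}{s-1}\zeta(\overline{k-2l})\right]\zeta(\overline{2l}),$$ and if $r=1$, then $$\zeta(r,\overline{s})=-\frac12\zeta(\overline{k})+(-1)^r\left[\sum_{l=0}^{\frac{k-3}{2}}\binom{k-2l-1}{r-1}\zeta(k-2l)\zeta(\overline{2l})+\sum_{l=0}^{\frac{k-1}{2}}\binom{k-2l-1}{s-1}\zeta(\overline{k-2l})\zeta(\overline{2l})\right].$$ 3. In all cases $$\zeta(\overline{r},\overline{s})=-\frac12\zeta(k)+\frac{1+(-1)^s}{2}\zeta(\overline{r})\zeta(\overline{s})+(-1)^r\sum_{l=0}^{\frac{k-1}{2}}\left[\binom{k-2l-1}{r-1}\zeta(\overline{k-2l})+\binom{k-2l-1}{s-1}\zeta(\overline{k-2l})\right]\zeta(2l).$$ -/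

import Mathlib

open scoped BigOperators

namespace DoubleEuler

/-- The single zeta value `ζ(k)` at a natural number `k`: the series `∑_{m ≥ 1} 1 / m ^ k` for
`k ≥ 2`, and `ζ(0) = -1/2`. (At `k = 1` the series diverges and the value means nothing.) -/
noncomputable def zeta (k : ℕ) : ℝ :=
  if k = 0 then -1 / 2 else ∑' n : ℕ, 1 / ((n : ℝ) + 1) ^ k

/-- The single alternating value `ζ(k̄)`: the (for `k = 1` only conditionally convergent) series
`∑_{m ≥ 1} (-1) ^ m / m ^ k` for `k ≥ 1`, and `ζ(0̄) = -1/2`. The sum over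
`SummationFilter.conditional ℕ` is the limit of the partial sums. -/
noncomputable def zetaBar (k : ℕ) : ℝ :=
  if k = 0 then -1 / 2
  else ∑'[SummationFilter.conditional ℕ] n : ℕ, (-1 : ℝ) ^ (n + 1) / ((n : ℝ) + 1) ^ k

/-- The term of index `m` of the series `ζ(r̄, s)`. -/
noncomputable def termBarLeft (r s m : ℕ) : ℝ :=
  1 / (m : ℝ) ^ s * ∑ j ∈ Finset.Icc 1 (m - 1), (-1 : ℝ) ^ j / (j : ℝ) ^ r

/-- The term of index `m` of the series `ζ(r, s̄)`. -/
noncomputable def termBarRight (r s m : ℕ) : ℝ :=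
  (-1 : ℝ) ^ m / (m : ℝ) ^ s * ∑ j ∈ Finset.Icc 1 (m - 1), 1 / (j : ℝ) ^ r

/-- The term of index `m` of the series `ζ(r̄, s̄)`. -/
noncomputable def termBarBoth (r s m : ℕ) : ℝ :=
  (-1 : ℝ) ^ m / (m : ℝ) ^ s * ∑ j ∈ Finset.Icc 1 (m - 1), (-1 : ℝ) ^ j / (j : ℝ) ^ r

/-- A series `∑_{m ≥ 2} f m` converges, as a limit of partial sums. -/
def Converges (f : ℕ → ℝ) : Prop :=
  Summable (fun n : ℕ => f (n + 2)) (SummationFilter.conditional ℕ)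

/-- The sum `∑_{m ≥ 2} f m`, as a limit of partial sums. -/
noncomputable def seriesSum (f : ℕ → ℝ) : ℝ :=
  ∑'[SummationFilter.conditional ℕ] n : ℕ, f (n + 2)

/-- `ζ(r̄, s) = ∑_{m ≥ 2} 1 / m ^ s * ∑_{1 ≤ j < m} (-1) ^ j / j ^ r`. -/
noncomputable def zetaBarLeft (r s : ℕ) : ℝ := seriesSum (termBarLeft r s)

/-- `ζ(r, s̄) = ∑_{m ≥ 2} (-1) ^ m / m ^ s * ∑_{1 ≤ j < m} 1 / j ^ r`. -/
noncomputable def zetaBarRight (r s : ℕ) : ℝ := seriesSum (termBarRight r s)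

/-- `ζ(r̄, s̄) = ∑_{m ≥ 2} (-1) ^ m / m ^ s * ∑_{1 ≤ j < m} (-1) ^ j / j ^ r`. -/
noncomputable def zetaBarBoth (r s : ℕ) : ℝ := seriesSum (termBarBoth r s)

end DoubleEuler

namespace DoubleEuler

open Finset Filter Topology

/-! Sum `σ^(j-n) τ^n / ((j-n)^r n^s)` over `1 ≤ j ≤ N`, `1 ≤ |n| ≤ N`, with `n = j` contributing
`0`, in two ways (`sum_sum_identity`). For fixed `n`, the sum over `j` telescopes; the signs `n > 0`
and `n < 0` each give a copy of the double sum, with factors `(-1)^r` and `-(-1)^s`. These agree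
because `r + s` is odd, so the copies add up. For fixed `j`, partial fractions in `n` leave only
sums over a symmetric range; parity keeps the even exponents `2l`, and products of single sums
remain.

All this is exact at finite `N`, up to shifts of upper bounds from `N` to `N ± m`. With outer
exponent at least `2` the shifts vanish in the limit by dominated convergence. The case `s = 1`
reduces to `s ≥ 2` by the stuffle product, which the evaluation satisfies as well
(`partialFormula_add_swap`).

So `tendsto_doublePartialSum_sub` compares partial sums with partial sums and needs no convergence.
Divergent harmonic sums are removed only afterwards, by a zero binomial coefficient or by exact
cancellation at each `N`. -/

/-! ### Partial fractions -/

/-- Expansion of `1 / (x ^ (a + 1) * y ^ (b + 1))` in powers of `1 / x`, `1 / y` and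
`1 / (x + y)`. -/
lemma partial_fraction (a b : ℕ) {x y : ℝ} (hx : x ≠ 0) (hy : y ≠ 0) (hxy : x + y ≠ 0) :
    1 / (x ^ (a + 1) * y ^ (b + 1)) = ∑ t ∈ range (a + b + 1),
      (((a + b - t).choose b : ℝ) / x ^ (t + 1) + ((a + b - t).choose a : ℝ) / y ^ (t + 1))
        / (x + y) ^ (a + b + 1 - t) := by
  have base : ∀ (b : ℕ) {x y : ℝ}, x ≠ 0 → y ≠ 0 → x + y ≠ 0 →
      1 / (x * y ^ (b + 1)) = 1 / (x * (x + y) ^ (b + 1))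
        + ∑ t ∈ range (b + 1), 1 / (y ^ (t + 1) * (x + y) ^ (b + 1 - t)) := by
    intro b x y hx hy hxy
    induction b with
    | zero => simp; field_simp; ring
    | succ b ih =>
      have h : 1 / (x * y ^ (b + 1 + 1))
          = (1 / y ^ (b + 1 + 1) + 1 / (x * y ^ (b + 1))) / (x + y) := by
        field_simp
        ring
      rw [h, ih, sum_range_succ _ (b + 1), add_div, add_div, sum_div]
      have h2 : ∀ t ∈ range (b + 1), 1 / (y ^ (t + 1) * (x + y) ^ (b + 1 - t)) / (x + y)
          = 1 / (y ^ (t + 1) * (x + y) ^ (b + 1 + 1 - t)) := by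
        intro t ht
        have : b + 1 + 1 - t = b + 1 - t + 1 := by have := mem_range.1 ht; omega
        rw [this, pow_succ (x + y), div_div, mul_assoc]
      rw [sum_congr rfl h2]
      have h3 : b + 1 + 1 - (b + 1) = 1 := by omega
      rw [h3]
      field_simp
      ring
  have base' : ∀ (b : ℕ) {x y : ℝ}, x ≠ 0 → y ≠ 0 → x + y ≠ 0 →
      1 / (x * y ^ (b + 1)) = ∑ t ∈ range (b + 1),
        (((b - t).choose b : ℝ) / x ^ (t + 1) + 1 / y ^ (t + 1)) / (x + y) ^ (b + 1 - t) := by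
    intro b x y hx hy hxy
    rw [base b hx hy hxy]
    simp only [add_div, sum_add_distrib, div_div]
    congr 1
    rw [sum_range_succ', sum_eq_zero]
    · simp
    · intro t ht
      rw [Nat.choose_eq_zero_of_lt (by have := mem_range.1 ht; omega)]
      simp
  induction a generalizing b with
  | zero => simpa using base' b hx hy hxy
  | succ a iha =>
    induction b with
    | zero =>
      have h := base' (a + 1) hy hx (by rwa [add_comm])
      rw [zero_add, pow_one, mul_comm, h]
      refine sum_congr rfl fun t _ => ?_
      simp [add_comm]
    | succ b ihb =>
      -- Since `1 / (x y) = (1 / x + 1 / y) / (x + y)`, the coefficients obey Pascal's rule; the top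
      -- index adds nothing because both its binomials are `choose 0 (_ + 1)`.
      have h : 1 / (x ^ (a + 1 + 1) * y ^ (b + 1 + 1))
          = (1 / (x ^ (a + 1) * y ^ (b + 1 + 1)) + 1 / (x ^ (a + 1 + 1) * y ^ (b + 1)))
            / (x + y) := by
        field_simp
        ring
      have e1 : a + 1 + b = a + (b + 1) := by omega
      rw [h, iha (b + 1), ihb, e1, ← sum_add_distrib, sum_div]
      have e2 : a + 1 + (b + 1) + 1 = a + (b + 1) + 1 + 1 := by omega
      rw [e2, sum_range_succ _ (a + (b + 1) + 1)]
      have e3 : a + 1 + (b + 1) - (a + (b + 1) + 1) = 0 := by omega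
      rw [e3]
      simp only [Nat.choose_zero_succ, Nat.cast_zero, zero_div, add_zero]
      refine sum_congr rfl fun t ht => ?_
      have ht := mem_range.1 ht
      have e4 : a + 1 + (b + 1) - t = (a + (b + 1) - t) + 1 := by omega
      have e5 : a + (b + 1) + 1 + 1 - t = (a + (b + 1) + 1 - t) + 1 := by omega
      rw [e4, e5, Nat.choose_succ_succ, Nat.choose_succ_succ, pow_succ (x + y)]
      push_cast
      field_simp
      ring

/-! ### Partial sums over the integers and telescoping -/

/-- The partial sum `∑_{1 ≤ a ≤ N} ε ^ a / a ^ k`. -/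
noncomputable def partialSum (ε : ℝ) (k N : ℕ) : ℝ :=
  ∑ a ∈ range N, ε ^ (a + 1) / ((a : ℝ) + 1) ^ k

lemma partialSum_zero (ε : ℝ) (k : ℕ) : partialSum ε k 0 = 0 := by simp [partialSum]

lemma partialSum_succ (ε : ℝ) (k N : ℕ) :
    partialSum ε k (N + 1) = partialSum ε k N + ε ^ (N + 1) / ((N : ℝ) + 1) ^ k := by
  simp [partialSum, sum_range_succ]

/-- The term `ε ^ x / x ^ k` at an integer `x`; it is `0` at `x = 0` when `k ≠ 0`. -/
noncomputable def intTerm (ε : ℝ) (k : ℕ) (x : ℤ) : ℝ := ε ^ x / (x : ℝ) ^ k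

/-- The partial sums of `intTerm`, extended to negative integers by telescoping. -/
noncomputable def intSum (ε : ℝ) (k : ℕ) : ℤ → ℝ
  | Int.ofNat n => partialSum ε k n
  -- At `-(n + 1)` the terms to remove are those at `-n, ..., 0`; the one at `0` vanishes for `k ≠
  -- 0`, so the length is `n`, not `n + 1`.
  | Int.negSucc n => -(-1) ^ k * partialSum ε k n

lemma intSum_natCast (ε : ℝ) (k n : ℕ) : intSum ε k (n : ℤ) = partialSum ε k n := rfl

lemma intSum_neg (ε : ℝ) (k n : ℕ) :
    intSum ε k (-((n : ℤ) + 1)) = -(-1) ^ k * partialSum ε k n := by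
  have : (-((n : ℤ) + 1)) = Int.negSucc n := by rw [Int.negSucc_eq]
  rw [this]; rfl
lemma intTerm_natCast (ε : ℝ) (k n : ℕ) :
    intTerm ε k ((n : ℤ) + 1) = ε ^ (n + 1) / ((n : ℝ) + 1) ^ k := by
  unfold intTerm
  have : ((n : ℤ) + 1) = ((n + 1 : ℕ) : ℤ) := by push_cast; rfl
  rw [this, zpow_natCast]; push_cast; rfl

lemma sign_zpow_mul_self {ε : ℝ} (hε : ε = 1 ∨ ε = -1) (x : ℤ) : ε ^ x * ε ^ x = 1 := by
  rcases hε with rfl | rfl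
  · simp
  · rw [← mul_zpow]; norm_num

lemma sign_ne_zero {ε : ℝ} (hε : ε = 1 ∨ ε = -1) : ε ≠ 0 := by
  rcases hε with rfl | rfl <;> norm_num

lemma sign_mul {σ τ : ℝ} (hσ : σ = 1 ∨ σ = -1) (hτ : τ = 1 ∨ τ = -1) :
    σ * τ = 1 ∨ σ * τ = -1 := by
  rcases hσ with rfl | rfl <;> rcases hτ with rfl | rfl <;> norm_num

lemma sign_zpow_neg {ε : ℝ} (hε : ε = 1 ∨ ε = -1) (x : ℤ) : ε ^ (-x) = ε ^ x := by
  rw [zpow_neg]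
  exact (eq_inv_of_mul_eq_one_left (sign_zpow_mul_self hε x)).symm

lemma abs_sign_pow {ε : ℝ} (hε : ε = 1 ∨ ε = -1) (n : ℕ) : |ε ^ n| = 1 := by
  rcases hε with rfl | rfl <;> simp

lemma intTerm_neg {ε : ℝ} (hε : ε = 1 ∨ ε = -1) (k : ℕ) (x : ℤ) :
    intTerm ε k (-x) = (-1) ^ k * intTerm ε k x := by
  unfold intTerm
  rw [sign_zpow_neg hε, Int.cast_neg, neg_pow (x : ℝ)]
  have : ((-1 : ℝ) ^ k) * (-1) ^ k = 1 := by rw [← mul_pow]; simp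
  have h : ((-1 : ℝ) ^ k)⁻¹ = (-1) ^ k := inv_eq_of_mul_eq_one_left this
  rw [div_eq_mul_inv, mul_inv, h]
  ring

lemma intSum_sub {ε : ℝ} (hε : ε = 1 ∨ ε = -1) {k : ℕ} (hk : k ≠ 0) (x : ℤ) :
    intSum ε k x - intSum ε k (x - 1) = intTerm ε k x := by
  obtain ⟨n, rfl | rfl⟩ := x.eq_nat_or_neg
  · rcases n with _ | n
    · have h : ((0 : ℕ) : ℤ) - 1 = -(((0 : ℕ) : ℤ) + 1) := by simp
      rw [h, intSum_neg, intSum_natCast]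
      simp [partialSum_zero, intTerm, hk]
    · have h : ((n + 1 : ℕ) : ℤ) - 1 = n := by push_cast; ring
      rw [h, intSum_natCast, intSum_natCast, partialSum_succ]
      push_cast
      rw [intTerm_natCast]
      ring
  · rcases n with _ | n
    · have h : -((0 : ℕ) : ℤ) - 1 = -(((0 : ℕ) : ℤ) + 1) := by simp
      have h' : -((0 : ℕ) : ℤ) = ((0 : ℕ) : ℤ) := by simp
      rw [h, h', intSum_neg, intSum_natCast]
      simp [partialSum_zero, intTerm, hk]
    · have h : -((n + 1 : ℕ) : ℤ) - 1 = -(((n + 1 : ℕ) : ℤ) + 1) := by ring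
      rw [h, intSum_neg, partialSum_succ, intTerm_neg hε]
      push_cast
      rw [intSum_neg, intTerm_natCast]
      ring

lemma sum_intTerm_shift {ε : ℝ} (hε : ε = 1 ∨ ε = -1) {k : ℕ} (hk : k ≠ 0) (n : ℤ) (N : ℕ) :
    ∑ j ∈ range N, intTerm ε k ((j : ℤ) + 1 + n) = intSum ε k (N + n) - intSum ε k n := by
  induction N with
  | zero => simp
  | succ N ih =>
    rw [sum_range_succ, ih, ← intSum_sub hε hk]
    have h : (N : ℤ) + 1 + n - 1 = N + n := by ring
    rw [h]
    push_cast
    ring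

/-- The two halves fill an interval of integers centred at `j` except for its midpoint, whence the
subtracted `intTerm ε k j`. -/
lemma sum_intTerm_symm {ε : ℝ} (hε : ε = 1 ∨ ε = -1) {k : ℕ} (hk : k ≠ 0) (j : ℤ) (N : ℕ) :
    ∑ m ∈ range N, (intTerm ε k (j - ((m : ℤ) + 1)) + intTerm ε k (j + ((m : ℤ) + 1)))
      = intSum ε k (j + N) - intSum ε k (j - N - 1) - intTerm ε k j := by
  induction N with
  | zero => simp [← intSum_sub hε hk j]
  | succ N ih =>
    rw [sum_range_succ, ih, ← intSum_sub hε hk (j - ((N : ℤ) + 1)),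
      ← intSum_sub hε hk (j + ((N : ℤ) + 1))]
    have h : j + ((N : ℤ) + 1) - 1 = j + N := by ring
    have h' : j - ((N : ℤ) + 1) = j - N - 1 := by ring
    rw [h, h']
    push_cast
    have h'' : j - ((N : ℤ) + 1) - 1 = j - N - 1 - 1 := by ring
    rw [h'']
    ring

/-! ### The finite identity from two orders of summation -/

/-- The partial sum of the terms of index `2 ≤ m ≤ N` of the double series with signs `σ`, `τ`. -/
noncomputable def doublePartialSum (σ τ : ℝ) (r s N : ℕ) : ℝ :=
  ∑ m ∈ range N, τ ^ (m + 1) / ((m : ℝ) + 1) ^ s * partialSum σ r m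

/-- Partial fractions combined with `σ^(j-n) τ^n = τ^j (στ)^(j-n) = σ^j (στ)^n`. At `n = j` the left
side is `0` by the division convention while the expansion is not, so its value there is subtracted.
-/
lemma intTerm_mul_intTerm {σ τ : ℝ} (hσ : σ = 1 ∨ σ = -1) (hτ : τ = 1 ∨ τ = -1) (a b : ℕ)
    (j n : ℤ) (hj : j ≠ 0) (hn : n ≠ 0) :
    intTerm σ (a + 1) (j - n) * intTerm τ (b + 1) n
      = ∑ t ∈ range (a + b + 1),
          (((a + b - t).choose b : ℝ) * τ ^ j * intTerm (σ * τ) (t + 1) (j - n)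
            + ((a + b - t).choose a : ℝ) * σ ^ j * intTerm (σ * τ) (t + 1) n)
            / (j : ℝ) ^ (a + b + 1 - t)
        - if n = j then τ ^ j / (j : ℝ) ^ (a + b + 2)
            * ∑ t ∈ range (a + b + 1), ((a + b - t).choose a : ℝ) else 0 := by
  have hj' : (j : ℝ) ≠ 0 := by exact_mod_cast hj
  split_ifs with h
  · subst h
    simp only [sub_self]
    have h0 : ∀ ε : ℝ, ∀ k : ℕ, intTerm ε (k + 1) 0 = 0 := by intro ε k; simp [intTerm]
    simp only [h0, zero_mul, mul_zero, zero_add]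
    symm
    rw [sub_eq_zero, mul_sum]
    refine sum_congr rfl fun t ht => ?_
    have ht := mem_range.1 ht
    unfold intTerm
    have e : a + b + 2 = (t + 1) + (a + b + 1 - t) := by omega
    have h1 : σ ^ n * (σ ^ n * τ ^ n) = τ ^ n := by rw [← mul_assoc, sign_zpow_mul_self hσ, one_mul]
    rw [e, pow_add, mul_zpow, ← mul_div_assoc, mul_assoc, h1, div_div]
    ring
  · rw [sub_zero]
    have hn' : (n : ℝ) ≠ 0 := by exact_mod_cast hn
    have hx : ((j - n : ℤ) : ℝ) ≠ 0 := by exact_mod_cast sub_ne_zero.2 (Ne.symm h)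
    have hs : ((j - n : ℤ) : ℝ) + (n : ℝ) = j := by push_cast; ring
    have key := partial_fraction a b hx hn' (by rwa [hs])
    rw [hs] at key
    have e : intTerm σ (a + 1) (j - n) * intTerm τ (b + 1) n
        = σ ^ (j - n) * τ ^ n
          * (1 / (((j - n : ℤ) : ℝ) ^ (a + 1) * (n : ℝ) ^ (b + 1))) := by
      unfold intTerm; field_simp
    rw [e, key, mul_sum]
    refine sum_congr rfl fun t _ => ?_
    have e1 : σ ^ (j - n) * τ ^ n = τ ^ j * (σ * τ) ^ (j - n) := by
      have : τ ^ j = τ ^ (j - n) * τ ^ n := by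
        rw [← zpow_add₀ (sign_ne_zero hτ)]; congr 1; ring
      rw [this, mul_zpow]
      linear_combination -σ ^ (j - n) * τ ^ n * sign_zpow_mul_self hτ (j - n)
    have e2 : σ ^ (j - n) * τ ^ n = σ ^ j * (σ * τ) ^ n := by
      have : σ ^ j = σ ^ (j - n) * σ ^ n := by
        rw [← zpow_add₀ (sign_ne_zero hσ)]; congr 1; ring
      rw [this, mul_zpow]
      linear_combination -σ ^ (j - n) * τ ^ n * sign_zpow_mul_self hσ n
    unfold intTerm
    rw [← mul_div_assoc, mul_add]
    congr 2
    · rw [e1]; ring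
    · rw [e2]; ring

/-- Summation of `σ ^ (j - n) * τ ^ n / ((j - n) ^ (a + 1) * n ^ (b + 1))` over `1 ≤ j ≤ N` and
`1 ≤ |n| ≤ N` in both orders. -/
lemma sum_sum_identity {σ τ : ℝ} (hσ : σ = 1 ∨ σ = -1) (hτ : τ = 1 ∨ τ = -1) (a b N : ℕ) :
    ∑ m ∈ range N, τ ^ (m + 1) / ((m : ℝ) + 1) ^ (b + 1) *
        ((-1) ^ (a + 1) * partialSum σ (a + 1) m + partialSum σ (a + 1) (N - (m + 1))
          + (-1) ^ (b + 1) *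
            (partialSum σ (a + 1) (N + (m + 1)) - partialSum σ (a + 1) (m + 1)))
      = ∑ j ∈ range N, (∑ t ∈ range (a + b + 1),
          (((a + b - t).choose b : ℝ) * τ ^ (j + 1)
              * (partialSum (σ * τ) (t + 1) (N + (j + 1))
                + (-1) ^ (t + 1) * partialSum (σ * τ) (t + 1) (N - (j + 1)))
            + ((a + b - t).choose a : ℝ) * σ ^ (j + 1)
              * ((1 + (-1) ^ (t + 1)) * partialSum (σ * τ) (t + 1) N))
            / ((j : ℝ) + 1) ^ (a + b + 1 - t)
          - ((∑ t ∈ range (a + b + 1), ((a + b - t).choose b : ℝ)) * σ ^ (j + 1)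
            + (∑ t ∈ range (a + b + 1), ((a + b - t).choose a : ℝ)) * τ ^ (j + 1))
            / ((j : ℝ) + 1) ^ (a + b + 2)) := by
  have hστ := sign_mul hσ hτ
  have zc : ∀ (ε : ℝ) (j : ℕ), ε ^ ((j : ℤ) + 1) = ε ^ (j + 1) := by
    intro ε j
    have : ((j : ℤ) + 1) = ((j + 1 : ℕ) : ℤ) := by push_cast; rfl
    rw [this, zpow_natCast]
  trans ∑ j ∈ range N, ∑ m ∈ range N,
      (intTerm σ (a + 1) (((j : ℤ) + 1) - ((m : ℤ) + 1)) * intTerm τ (b + 1) ((m : ℤ) + 1)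
      + intTerm σ (a + 1) (((j : ℤ) + 1) - (-((m : ℤ) + 1))) * intTerm τ (b + 1) (-((m : ℤ) + 1)))
  -- Fixed `n`: the sum over `j` telescopes.
  · rw [sum_comm]
    refine sum_congr rfl fun m hm => ?_
    have hm := mem_range.1 hm
    simp only [intTerm_neg hτ (b + 1), sum_add_distrib, ← sum_mul, sub_eq_add_neg _ (-_), neg_neg,
      sub_eq_add_neg _ ((m : ℤ) + 1)]
    rw [sum_intTerm_shift hσ (Nat.add_one_ne_zero a), sum_intTerm_shift hσ (Nat.add_one_ne_zero a),
      intTerm_natCast, intSum_neg]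
    have h1 : (N : ℤ) + -((m : ℤ) + 1) = ((N - (m + 1) : ℕ) : ℤ) := by omega
    have h2 : (N : ℤ) + ((m : ℤ) + 1) = ((N + (m + 1) : ℕ) : ℤ) := by omega
    have h3 : ((m : ℤ) + 1) = ((m + 1 : ℕ) : ℤ) := by omega
    rw [h1, h2, h3]
    simp only [intSum_natCast]
    ring
  · refine sum_congr rfl fun j hj => ?_
    have hj := mem_range.1 hj
    have hj0 : (j : ℤ) + 1 ≠ 0 := by omega
    have hm0 : ∀ m : ℕ, (m : ℤ) + 1 ≠ 0 := by intro m; omega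
    have hm1 : ∀ m : ℕ, -((m : ℤ) + 1) ≠ 0 := by intro m; omega
    have hne : ∀ m : ℕ, -((m : ℤ) + 1) ≠ (j : ℤ) + 1 := by intro m; omega
    have heq : ∀ m : ℕ, ((m : ℤ) + 1 = (j : ℤ) + 1) ↔ m = j := by intro m; omega
    simp only [fun m : ℕ => intTerm_mul_intTerm hσ hτ a b _ _ hj0 (hm0 m),
      fun m : ℕ => intTerm_mul_intTerm hσ hτ a b _ _ hj0 (hm1 m), hne, heq, if_false, sub_zero]
    rw [sum_congr rfl (fun m _ => sub_add_eq_add_sub _ _ _), sum_sub_distrib, sum_ite_eq',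
      if_pos (mem_range.2 hj)]
    simp only [← sum_add_distrib, ← add_div]
    rw [sum_comm]
    simp only [← sum_div]
    -- Fixed `j` and exponent `t + 1`: the omitted `n = 0` gives the last term, and pairing `n` with
    -- `-n` gives the factor `1 + (-1)^(t+1)`.
    have inner : ∀ t : ℕ, ∑ m ∈ range N,
        (((a + b - t).choose b : ℝ) * τ ^ ((j : ℤ) + 1)
            * intTerm (σ * τ) (t + 1) ((j : ℤ) + 1 - ((m : ℤ) + 1))
          + ((a + b - t).choose a : ℝ) * σ ^ ((j : ℤ) + 1) * intTerm (σ * τ) (t + 1) ((m : ℤ) + 1)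
          + (((a + b - t).choose b : ℝ) * τ ^ ((j : ℤ) + 1)
            * intTerm (σ * τ) (t + 1) ((j : ℤ) + 1 - -((m : ℤ) + 1))
          + ((a + b - t).choose a : ℝ) * σ ^ ((j : ℤ) + 1)
            * intTerm (σ * τ) (t + 1) (-((m : ℤ) + 1))))
        = (((a + b - t).choose b : ℝ) * τ ^ (j + 1)
              * (partialSum (σ * τ) (t + 1) (N + (j + 1))
                + (-1) ^ (t + 1) * partialSum (σ * τ) (t + 1) (N - (j + 1)))
            + ((a + b - t).choose a : ℝ) * σ ^ (j + 1)
              * ((1 + (-1) ^ (t + 1)) * partialSum (σ * τ) (t + 1) N))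
          - ((a + b - t).choose b : ℝ) * σ ^ (j + 1) / ((j : ℝ) + 1) ^ (t + 1) := by
      intro t
      have s1 := sum_intTerm_symm hστ (Nat.add_one_ne_zero t) ((j : ℤ) + 1) N
      have h1 : (j : ℤ) + 1 + N = ((N + (j + 1) : ℕ) : ℤ) := by omega
      have h2 : (j : ℤ) + 1 - N - 1 = -(((N - (j + 1) : ℕ) : ℤ) + 1) := by omega
      rw [h1, h2, intSum_natCast, intSum_neg, intTerm_natCast] at s1
      have s2 : ∑ m ∈ range N, intTerm (σ * τ) (t + 1) ((m : ℤ) + 1)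
          = partialSum (σ * τ) (t + 1) N :=
        sum_congr rfl fun m _ => intTerm_natCast _ _ _
      have e : σ ^ (j + 1) = τ ^ (j + 1) * (σ * τ) ^ (j + 1) := by
        have := sign_zpow_mul_self hτ ((j : ℤ) + 1)
        rw [zc] at this
        rw [mul_pow]
        linear_combination -σ ^ (j + 1) * this
      trans ((a + b - t).choose b : ℝ) * τ ^ (j + 1) * (∑ m ∈ range N,
          (intTerm (σ * τ) (t + 1) ((j : ℤ) + 1 - ((m : ℤ) + 1))
            + intTerm (σ * τ) (t + 1) ((j : ℤ) + 1 + ((m : ℤ) + 1))))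
          + ((a + b - t).choose a : ℝ) * σ ^ (j + 1) * ((1 + (-1) ^ (t + 1)) *
            ∑ m ∈ range N, intTerm (σ * τ) (t + 1) ((m : ℤ) + 1))
      · rw [mul_sum, mul_sum, mul_sum, ← sum_add_distrib]
        refine sum_congr rfl fun m _ => ?_
        rw [intTerm_neg hστ, zc, zc, sub_neg_eq_add]
        ring
      · rw [s1, s2, mul_div_assoc (((a + b - t).choose b : ℝ)), e]
        ring
    simp only [inner]
    simp only [zc, sub_div _ (_ / _), sum_sub_distrib]
    have hc : ∑ t ∈ range (a + b + 1), ((a + b - t).choose b : ℝ) * σ ^ (j + 1)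
          / ((j : ℝ) + 1) ^ (t + 1) / ((j : ℝ) + 1) ^ (a + b + 1 - t)
        = (∑ t ∈ range (a + b + 1), ((a + b - t).choose b : ℝ)) * σ ^ (j + 1)
          / ((j : ℝ) + 1) ^ (a + b + 2) := by
      rw [sum_mul, sum_div]
      refine sum_congr rfl fun t ht => ?_
      have ht := mem_range.1 ht
      have e : a + b + 2 = (t + 1) + (a + b + 1 - t) := by omega
      rw [div_div, ← pow_add, ← e]
    push_cast
    rw [hc]
    ring

/-! ### Vanishing of the shift errors -/

lemma abs_partialSum_add_sub_le {ε : ℝ} (hε : ε = 1 ∨ ε = -1) {k : ℕ} (hk : k ≠ 0) (N m : ℕ) :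
    |partialSum ε k (N + m) - partialSum ε k N| ≤ ∑ i ∈ range m, 1 / ((N : ℝ) + i + 1) := by
  unfold partialSum
  rw [sum_range_add, add_sub_cancel_left]
  refine (abs_sum_le_sum_abs _ _).trans (sum_le_sum fun i _ => ?_)
  rw [abs_div, abs_sign_pow hε]
  push_cast
  have h1 : (1 : ℝ) ≤ (N : ℝ) + i + 1 := by
    have : (0 : ℝ) ≤ (N : ℝ) + i := by positivity
    linarith
  rw [abs_of_nonneg (by positivity)]
  exact one_div_le_one_div_of_le (by linarith) (le_self_pow₀ h1 hk)

/-- A bound uniform in `N`, for use as a dominating function. The growth is really logarithmic, but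
a square root is already summable against `1 / m^2`. -/
lemma abs_partialSum_add_sub_le_sqrt {ε : ℝ} (hε : ε = 1 ∨ ε = -1) {k : ℕ} (hk : k ≠ 0)
    (N m : ℕ) : |partialSum ε k (N + m) - partialSum ε k N| ≤ 2 * √m := by
  have h : ∀ m : ℕ, ∑ i ∈ range m, 1 / ((i : ℝ) + 1) ≤ 2 * √m := by
    intro m
    induction m with
    | zero => simp
    | succ m ih =>
      rw [sum_range_succ]
      push_cast
      have h0 : (0 : ℝ) ≤ m := by positivity
      have h1 : 0 < √((m : ℝ) + 1) := Real.sqrt_pos.2 (by linarith)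
      have h2 : √(m : ℝ) ^ 2 = m := Real.sq_sqrt h0
      have h3 : √((m : ℝ) + 1) ^ 2 = m + 1 := Real.sq_sqrt (by linarith)
      have h4 : 1 / ((m : ℝ) + 1) ≤ 2 * √((m : ℝ) + 1) - 2 * √(m : ℝ) := by
        rw [div_le_iff₀ (by linarith)]
        have h5 : √(m : ℝ) ≤ √((m : ℝ) + 1) := Real.sqrt_le_sqrt (by linarith)
        have h6 : (1 : ℝ) ≤ √((m : ℝ) + 1) := Real.one_le_sqrt.2 (by linarith)
        have h7 : (√((m : ℝ) + 1) - √(m : ℝ)) * (√((m : ℝ) + 1) + √(m : ℝ)) = 1 := by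
          linear_combination h3 - h2
        -- With `u = √(m+1)` and `v = √m`, `(u - v)(u + v) = 1` turns this into `1 ≤ 2 (u - v)(m +
        -- 1)`.
        have h8 : 0 ≤ (√((m : ℝ) + 1) - √(m : ℝ)) * (2 * √((m : ℝ) + 1) ^ 2 - √((m : ℝ) + 1) - √m) :=
          mul_nonneg (sub_nonneg.2 h5) (by nlinarith)
        linear_combination h8 + 2 * (√((m : ℝ) + 1) - √(m : ℝ)) * h3 - h7
      linarith
  refine (abs_partialSum_add_sub_le hε hk N m).trans (le_trans (sum_le_sum fun i _ => ?_) (h m))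
  exact one_div_le_one_div_of_le (by positivity) (by linarith [Nat.cast_nonneg (α := ℝ) N])

lemma tendsto_partialSum_add_sub {ε : ℝ} (hε : ε = 1 ∨ ε = -1) {k : ℕ} (hk : k ≠ 0) (m : ℕ) :
    Tendsto (fun N => partialSum ε k (N + m) - partialSum ε k N) atTop (𝓝 0) := by
  have h : Tendsto (fun N : ℕ => ∑ i ∈ range m, 1 / ((N : ℝ) + i + 1)) atTop (𝓝 0) := by
    rw [← sum_const_zero (s := range m)]
    refine tendsto_finsetSum _ fun i _ => ?_
    have := (tendsto_one_div_add_atTop_nhds_zero_nat (𝕜 := ℝ)).comp (tendsto_add_atTop_nat i)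
    refine this.congr fun N => ?_
    simp
  exact squeeze_zero_norm (fun N => abs_partialSum_add_sub_le hε hk N m) h

lemma summable_sqrt_div {q : ℕ} (hq : 2 ≤ q) :
    Summable fun m : ℕ => 2 * √((m : ℝ) + 1) / ((m : ℝ) + 1) ^ q := by
  have h := ((Real.summable_one_div_nat_add_rpow 1 (3 / 2)).2 (by norm_num)).mul_left 2
  refine Summable.of_nonneg_of_le (fun m => by positivity) (fun m => ?_) h
  have hm : (1 : ℝ) ≤ (m : ℝ) + 1 := by linarith [Nat.cast_nonneg (α := ℝ) m]
  rw [abs_of_pos (by linarith), mul_div_assoc]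
  refine mul_le_mul_of_nonneg_left ?_ zero_le_two
  have h2 : √((m : ℝ) + 1) * ((m : ℝ) + 1) ^ (3 / 2 : ℝ) = ((m : ℝ) + 1) ^ 2 := by
    rw [Real.sqrt_eq_rpow, ← Real.rpow_add (by linarith), ← Real.rpow_natCast]
    norm_num
  rw [div_le_div_iff₀ (by positivity) (by positivity), h2, one_mul]
  exact pow_le_pow_right₀ hm hq

/-- Tannery's theorem, with the finite sums written as series cut off at `N`. -/
lemma tendsto_sum_mul_of_dominated {τ : ℝ} (hτ : τ = 1 ∨ τ = -1) {q : ℕ} (hq : 2 ≤ q)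
    {f : ℕ → ℕ → ℝ} (hf : ∀ N m, m < N → |f N m| ≤ 2 * √((m : ℝ) + 1))
    (hlim : ∀ m, Tendsto (fun N => f N m) atTop (𝓝 0)) :
    Tendsto (fun N => ∑ m ∈ range N, τ ^ (m + 1) / ((m : ℝ) + 1) ^ q * f N m) atTop (𝓝 0) := by
  have h := tendsto_tsum_of_dominated_convergence (𝓕 := atTop)
    (f := fun N m : ℕ => if m < N then τ ^ (m + 1) / ((m : ℝ) + 1) ^ q * f N m else 0)
    (g := fun _ => (0 : ℝ)) (summable_sqrt_div hq) ?_ ?_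
  · rw [tsum_zero] at h
    refine h.congr fun N => ?_
    rw [tsum_eq_sum (s := range N) fun m hm => if_neg (by simpa using hm)]
    exact sum_congr rfl fun m hm => if_pos (mem_range.1 hm)
  · intro m
    have := (hlim m).const_mul (τ ^ (m + 1) / ((m : ℝ) + 1) ^ q)
    rw [mul_zero] at this
    refine this.congr' ?_
    filter_upwards [eventually_gt_atTop m] with N hN
    rw [if_pos hN]
  · refine Eventually.of_forall fun N m => ?_
    split_ifs with hm
    · rw [Real.norm_eq_abs, abs_mul, abs_div, abs_sign_pow hτ, mul_comm, ← div_eq_mul_one_div,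
        abs_of_nonneg (by positivity : (0 : ℝ) ≤ ((m : ℝ) + 1) ^ q)]
      gcongr
      exact hf N m hm
    · rw [norm_zero]; positivity

/-- Shifting the upper bound of the inner sum upwards by the outer index does not matter in the
limit. -/
lemma tendsto_sum_mul_partialSum_add {ε τ : ℝ} (hε : ε = 1 ∨ ε = -1) (hτ : τ = 1 ∨ τ = -1)
    {k q : ℕ} (hk : k ≠ 0) (hq : 2 ≤ q) :
    Tendsto (fun N => ∑ m ∈ range N, τ ^ (m + 1) / ((m : ℝ) + 1) ^ q *
      (partialSum ε k (N + (m + 1)) - partialSum ε k N)) atTop (𝓝 0) := by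
  refine tendsto_sum_mul_of_dominated hτ hq (fun N m _ => ?_)
    fun m => tendsto_partialSum_add_sub hε hk (m + 1)
  exact_mod_cast abs_partialSum_add_sub_le_sqrt hε hk N (m + 1)

/-- Shifting the upper bound of the inner sum downwards by the outer index does not matter in the
limit. -/
lemma tendsto_sum_mul_partialSum_sub {ε τ : ℝ} (hε : ε = 1 ∨ ε = -1) (hτ : τ = 1 ∨ τ = -1)
    {k q : ℕ} (hk : k ≠ 0) (hq : 2 ≤ q) :
    Tendsto (fun N => ∑ m ∈ range N, τ ^ (m + 1) / ((m : ℝ) + 1) ^ q *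
      (partialSum ε k (N - (m + 1)) - partialSum ε k N)) atTop (𝓝 0) := by
  refine tendsto_sum_mul_of_dominated hτ hq (fun N m hm => ?_) fun m => ?_
  · have h := abs_partialSum_add_sub_le_sqrt hε hk (N - (m + 1)) (m + 1)
    rw [Nat.sub_add_cancel hm, abs_sub_comm] at h
    exact_mod_cast h
  · have h := ((tendsto_partialSum_add_sub hε hk (m + 1)).comp
      (tendsto_sub_atTop_nat (m + 1))).neg
    rw [neg_zero] at h
    refine h.congr' ?_
    filter_upwards [eventually_ge_atTop (m + 1)] with N hN
    simp only [Function.comp_apply]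
    rw [Nat.sub_add_cancel hN, neg_sub]

/-! ### Comparison with the evaluation in partial sums -/

lemma sum_choose_sub (n k : ℕ) :
    ∑ t ∈ range (n + 1), ((n - t).choose k : ℝ) = ((n + 1).choose (k + 1) : ℝ) := by
  induction n with
  | zero =>
    cases k with
    | zero => simp
    | succ k => simp [Nat.choose_eq_zero_of_lt]
  | succ n ih =>
    rw [sum_range_succ', sum_congr rfl (fun t _ => by rw [Nat.add_sub_add_right]), ih,
      Nat.choose_succ_succ (n + 1) k]
    push_cast
    simp [add_comm]

lemma sum_range_even_filter (g : ℕ → ℝ) (M : ℕ) :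
    ∑ t ∈ range (2 * M), (1 + (-1) ^ (t + 1)) * g t = 2 * ∑ l ∈ range M, g (2 * l + 1) := by
  induction M with
  | zero => simp
  | succ M ih =>
    have h : 2 * (M + 1) = 2 * M + 1 + 1 := by ring
    rw [h, sum_range_succ, sum_range_succ, ih, sum_range_succ, mul_add]
    have h1 : (-1 : ℝ) ^ (2 * M) = 1 := by simp
    rw [pow_succ, pow_succ, pow_succ, h1]
    ring

/-- The partial sum of a single zeta value, with the value `-1/2` at `k = 0`. -/
noncomputable def partialValue (ε : ℝ) (k N : ℕ) : ℝ :=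
  if k = 0 then -1 / 2 else partialSum ε k N

/-- The evaluation of the double series with all single zeta values replaced by partial sums. -/
noncomputable def partialFormula (σ τ : ℝ) (r s N : ℕ) : ℝ :=
  -(1 / 2) * partialSum (σ * τ) (r + s) N
    + (1 + (-1 : ℝ) ^ s) / 2 * (partialSum σ r N * partialSum τ s N)
    + (-1 : ℝ) ^ r * ∑ l ∈ Icc 0 ((r + s - 1) / 2),
        (((r + s - 2 * l - 1).choose (r - 1) : ℝ) * partialSum σ (r + s - 2 * l) N
          + ((r + s - 2 * l - 1).choose (s - 1) : ℝ) * partialSum τ (r + s - 2 * l) N)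
        * partialValue (σ * τ) (2 * l) N

/-- The summands `l ≥ 1` are the indices with `t + 1 = 2l`. The summand `l = 0` is the diagonal
correction: doubling the value `-1/2` gives `-1`, and the hockey-stick identity with binomial
symmetry matches the coefficients. -/
lemma partialFormula_eq (σ τ : ℝ) {a b M : ℕ} (hM : a + b = 2 * M + 1) (N : ℕ) :
    2 * (-1) ^ (a + 1) * partialFormula σ τ (a + 1) (b + 1) N
      = -(-1) ^ (a + 1) * partialSum (σ * τ) (a + b + 2) N
        - (1 - (-1) ^ (a + 1)) * (partialSum σ (a + 1) N * partialSum τ (b + 1) N)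
        + ∑ t ∈ range (a + b + 1), (1 + (-1) ^ (t + 1)) *
          ((((a + b - t).choose a : ℝ) * partialSum σ (a + b + 1 - t) N
            + ((a + b - t).choose b : ℝ) * partialSum τ (a + b + 1 - t) N)
              * partialSum (σ * τ) (t + 1) N)
        - (∑ t ∈ range (a + b + 1), ((a + b - t).choose b : ℝ)) * partialSum σ (a + b + 2) N
        - (∑ t ∈ range (a + b + 1), ((a + b - t).choose a : ℝ)) * partialSum τ (a + b + 2) N := by
  rw [sum_choose_sub, sum_choose_sub]
  have e1 : a + b + 1 = 2 * (M + 1) := by omega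
  have e2 : (a + 1 + (b + 1) - 1) / 2 = M + 1 := by omega
  have e3 : a + 1 + (b + 1) = a + b + 2 := by omega
  have hs : (-1 : ℝ) ^ (b + 1) = -(-1) ^ (a + 1) := by
    have h : (-1 : ℝ) ^ (a + 1) * (-1) ^ (b + 1) = -1 := by
      rw [← pow_add, e3]
      exact Odd.neg_one_pow ⟨M + 1, by omega⟩
    rcases neg_one_pow_eq_or ℝ (a + 1) with h1 | h1 <;> rw [h1] at h ⊢ <;> linarith
  have hs2 : (-1 : ℝ) ^ (a + 1) * (-1) ^ (a + 1) = 1 := by rw [← mul_pow]; simp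
  have c1 : (a + b + 1).choose (b + 1) = (a + b + 1).choose a := by
    rw [← Nat.choose_symm_of_eq_add (show a + b + 1 = a + (b + 1) by omega)]
  have c2 : (a + b + 1).choose (a + 1) = (a + b + 1).choose b := by
    rw [← Nat.choose_symm_of_eq_add (show a + b + 1 = b + (a + 1) by omega)]
  unfold partialFormula
  rw [e2, ← Nat.range_succ_eq_Icc_zero, sum_range_succ', hs, c1, c2]
  rw [show range (a + b + 1) = range (2 * (M + 1)) by rw [e1]]
  rw [sum_range_even_filter]
  have hl : ∀ l ∈ range (M + 1),
      (((a + 1 + (b + 1) - 2 * (l + 1) - 1).choose (a + 1 - 1) : ℝ)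
          * partialSum σ (a + 1 + (b + 1) - 2 * (l + 1)) N
        + ((a + 1 + (b + 1) - 2 * (l + 1) - 1).choose (b + 1 - 1) : ℝ)
          * partialSum τ (a + 1 + (b + 1) - 2 * (l + 1)) N)
        * partialValue (σ * τ) (2 * (l + 1)) N
      = (((a + b - (2 * l + 1)).choose a : ℝ) * partialSum σ (a + b + 1 - (2 * l + 1)) N
          + ((a + b - (2 * l + 1)).choose b : ℝ) * partialSum τ (a + b + 1 - (2 * l + 1)) N)
        * partialSum (σ * τ) (2 * l + 1 + 1) N := by
    intro l _
    have f1 : a + 1 + (b + 1) - 2 * (l + 1) = a + b + 1 - (2 * l + 1) := by omega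
    have f2 : a + b + 1 - (2 * l + 1) - 1 = a + b - (2 * l + 1) := by omega
    rw [f1, f2, partialValue, if_neg (by omega)]
    rfl
  rw [sum_congr rfl hl]
  simp only [e3, mul_zero, Nat.sub_zero, partialValue, if_true, Nat.add_sub_cancel]
  have f3 : a + b + 2 - 1 = a + b + 1 := by omega
  rw [f3]
  linear_combination (2 * (∑ l ∈ range (M + 1),
      (((a + b - (2 * l + 1)).choose a : ℝ) * partialSum σ (a + b + 1 - (2 * l + 1)) N
          + ((a + b - (2 * l + 1)).choose b : ℝ) * partialSum τ (a + b + 1 - (2 * l + 1)) N)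
        * partialSum (σ * τ) (2 * l + 1 + 1) N)
      - (((a + b + 1).choose a : ℝ) * partialSum σ (a + b + 2) N
        + ((a + b + 1).choose b : ℝ) * partialSum τ (a + b + 2) N)
      - partialSum σ (a + 1) N * partialSum τ (b + 1) N) * hs2

lemma sum_mul_sign_div (ε c : ℝ) (k N : ℕ) :
    ∑ j ∈ range N, c * ε ^ (j + 1) / ((j : ℝ) + 1) ^ k = c * partialSum ε k N := by
  unfold partialSum
  rw [mul_sum]
  exact sum_congr rfl fun j _ => mul_div_assoc _ _ _

/-- `sum_sum_identity` with each shifted bound replaced by `N`: what remains is made of the errors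
that tend to zero. -/
lemma doublePartialSum_sub_partialFormula {σ τ : ℝ} (hσ : σ = 1 ∨ σ = -1)
    (hτ : τ = 1 ∨ τ = -1) {a b M : ℕ} (hM : a + b = 2 * M + 1) (N : ℕ) :
    2 * (-1) ^ (a + 1) * (doublePartialSum σ τ (a + 1) (b + 1) N
        - partialFormula σ τ (a + 1) (b + 1) N)
      = ∑ t ∈ range (a + b + 1), ((a + b - t).choose b : ℝ) *
          ((∑ j ∈ range N, τ ^ (j + 1) / ((j : ℝ) + 1) ^ (a + b + 1 - t) *
              (partialSum (σ * τ) (t + 1) (N + (j + 1)) - partialSum (σ * τ) (t + 1) N))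
            + (-1) ^ (t + 1) * ∑ j ∈ range N, τ ^ (j + 1) / ((j : ℝ) + 1) ^ (a + b + 1 - t) *
              (partialSum (σ * τ) (t + 1) (N - (j + 1)) - partialSum (σ * τ) (t + 1) N))
        - ∑ m ∈ range N, τ ^ (m + 1) / ((m : ℝ) + 1) ^ (b + 1) *
          (partialSum σ (a + 1) (N - (m + 1)) - partialSum σ (a + 1) N)
        + (-1) ^ (a + 1) * ∑ m ∈ range N, τ ^ (m + 1) / ((m : ℝ) + 1) ^ (b + 1) *
          (partialSum σ (a + 1) (N + (m + 1)) - partialSum σ (a + 1) N) := by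
  have key := sum_sum_identity hσ hτ a b N
  have hs : (-1 : ℝ) ^ (b + 1) = -(-1) ^ (a + 1) := by
    have h : (-1 : ℝ) ^ (a + 1) * (-1) ^ (b + 1) = -1 := by
      rw [← pow_add]
      exact Odd.neg_one_pow ⟨M + 1, by omega⟩
    rcases neg_one_pow_eq_or ℝ (a + 1) with h1 | h1 <;> rw [h1] at h ⊢ <;> linarith
  -- By `hs` the contributions of `partialSum σ (a + 1) m` and `partialSum σ (a + 1) (m + 1)` add;
  -- the extra term of the latter produces the single sum of weight `a + b + 2`.
  have lhs : ∑ m ∈ range N, τ ^ (m + 1) / ((m : ℝ) + 1) ^ (b + 1) *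
        ((-1) ^ (a + 1) * partialSum σ (a + 1) m + partialSum σ (a + 1) (N - (m + 1))
          + (-1) ^ (b + 1) *
            (partialSum σ (a + 1) (N + (m + 1)) - partialSum σ (a + 1) (m + 1)))
      = 2 * (-1) ^ (a + 1) * doublePartialSum σ τ (a + 1) (b + 1) N
        + (-1) ^ (a + 1) * partialSum (σ * τ) (a + b + 2) N
        + (1 - (-1) ^ (a + 1)) * (partialSum σ (a + 1) N * partialSum τ (b + 1) N)
        + ∑ m ∈ range N, τ ^ (m + 1) / ((m : ℝ) + 1) ^ (b + 1) *
          (partialSum σ (a + 1) (N - (m + 1)) - partialSum σ (a + 1) N)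
        - (-1) ^ (a + 1) * ∑ m ∈ range N, τ ^ (m + 1) / ((m : ℝ) + 1) ^ (b + 1) *
          (partialSum σ (a + 1) (N + (m + 1)) - partialSum σ (a + 1) N) := by
    have h1 : partialSum σ (a + 1) N * partialSum τ (b + 1) N
        = ∑ m ∈ range N, partialSum σ (a + 1) N * (τ ^ (m + 1) / ((m : ℝ) + 1) ^ (b + 1)) := by
      rw [← mul_sum]; rfl
    have h2 : partialSum (σ * τ) (a + b + 2) N
        = ∑ m ∈ range N, (σ * τ) ^ (m + 1) / ((m : ℝ) + 1) ^ (a + b + 2) := rfl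
    rw [h1, h2, hs]
    unfold doublePartialSum
    simp only [mul_sum, ← sum_add_distrib, ← sum_sub_distrib]
    refine sum_congr rfl fun m _ => ?_
    rw [partialSum_succ, mul_pow]
    have : a + b + 2 = (a + 1) + (b + 1) := by ring
    rw [this, pow_add _ (a + 1) (b + 1)]
    field_simp
    ring
  have rhs : ∑ j ∈ range N, (∑ t ∈ range (a + b + 1),
          (((a + b - t).choose b : ℝ) * τ ^ (j + 1)
              * (partialSum (σ * τ) (t + 1) (N + (j + 1))
                + (-1) ^ (t + 1) * partialSum (σ * τ) (t + 1) (N - (j + 1)))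
            + ((a + b - t).choose a : ℝ) * σ ^ (j + 1)
              * ((1 + (-1) ^ (t + 1)) * partialSum (σ * τ) (t + 1) N))
            / ((j : ℝ) + 1) ^ (a + b + 1 - t)
          - ((∑ t ∈ range (a + b + 1), ((a + b - t).choose b : ℝ)) * σ ^ (j + 1)
            + (∑ t ∈ range (a + b + 1), ((a + b - t).choose a : ℝ)) * τ ^ (j + 1))
            / ((j : ℝ) + 1) ^ (a + b + 2))
      = (∑ t ∈ range (a + b + 1), (1 + (-1) ^ (t + 1)) *
          ((((a + b - t).choose a : ℝ) * partialSum σ (a + b + 1 - t) N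
            + ((a + b - t).choose b : ℝ) * partialSum τ (a + b + 1 - t) N)
              * partialSum (σ * τ) (t + 1) N))
        + (∑ t ∈ range (a + b + 1), ((a + b - t).choose b : ℝ) *
          ((∑ j ∈ range N, τ ^ (j + 1) / ((j : ℝ) + 1) ^ (a + b + 1 - t) *
              (partialSum (σ * τ) (t + 1) (N + (j + 1)) - partialSum (σ * τ) (t + 1) N))
            + (-1) ^ (t + 1) * ∑ j ∈ range N, τ ^ (j + 1) / ((j : ℝ) + 1) ^ (a + b + 1 - t) *
              (partialSum (σ * τ) (t + 1) (N - (j + 1)) - partialSum (σ * τ) (t + 1) N)))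
        - (∑ t ∈ range (a + b + 1), ((a + b - t).choose b : ℝ)) * partialSum σ (a + b + 2) N
        - (∑ t ∈ range (a + b + 1), ((a + b - t).choose a : ℝ)) * partialSum τ (a + b + 2) N := by
    rw [sum_sub_distrib, sum_comm]
    simp only [add_div _ _ (_ ^ (a + b + 2)), sum_add_distrib (s := range N), sum_mul_sign_div]
    rw [← sub_sub, ← sum_add_distrib]
    congr 2
    refine sum_congr rfl fun t _ => ?_
    have p : ∀ ε : ℝ, partialSum ε (a + b + 1 - t) N
        = ∑ j ∈ range N, ε ^ (j + 1) / ((j : ℝ) + 1) ^ (a + b + 1 - t) := fun _ => rfl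
    rw [p, p]
    simp only [mul_add, add_mul, mul_sum, sum_mul, ← sum_add_distrib]
    refine sum_congr rfl fun j _ => ?_
    ring
  rw [lhs, rhs] at key
  rw [mul_sub, partialFormula_eq σ τ hM N]
  linear_combination key

/-- The case `s ≥ 2` of `tendsto_doublePartialSum_sub`. -/
lemma tendsto_doublePartialSum_sub_of_two_le {σ τ : ℝ} (hσ : σ = 1 ∨ σ = -1)
    (hτ : τ = 1 ∨ τ = -1) {a b : ℕ} (hab : Odd (a + b)) (hb : 1 ≤ b) :
    Tendsto (fun N => doublePartialSum σ τ (a + 1) (b + 1) N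
      - partialFormula σ τ (a + 1) (b + 1) N) atTop (𝓝 0) := by
  obtain ⟨M, hM⟩ := hab
  have hστ := sign_mul hσ hτ
  have h1 := tendsto_sum_mul_partialSum_sub hσ hτ (Nat.add_one_ne_zero a)
    (show 2 ≤ b + 1 by omega)
  have h2 := (tendsto_sum_mul_partialSum_add hσ hτ (Nat.add_one_ne_zero a)
    (show 2 ≤ b + 1 by omega)).const_mul ((-1 : ℝ) ^ (a + 1))
  have h3 : Tendsto (fun N => ∑ t ∈ range (a + b + 1), ((a + b - t).choose b : ℝ) *
          ((∑ j ∈ range N, τ ^ (j + 1) / ((j : ℝ) + 1) ^ (a + b + 1 - t) *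
              (partialSum (σ * τ) (t + 1) (N + (j + 1)) - partialSum (σ * τ) (t + 1) N))
            + (-1) ^ (t + 1) * ∑ j ∈ range N, τ ^ (j + 1) / ((j : ℝ) + 1) ^ (a + b + 1 - t) *
              (partialSum (σ * τ) (t + 1) (N - (j + 1)) - partialSum (σ * τ) (t + 1) N)))
      atTop (𝓝 0) := by
    rw [← sum_const_zero (s := range (a + b + 1))]
    refine tendsto_finsetSum _ fun t ht => ?_
    have ht := mem_range.1 ht
    rcases Nat.lt_or_ge (a + b + 1 - t) 2 with hlt | hge
    -- Outer exponent `1` escapes domination, but occurs only at `t = a + b`, where the coefficient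
    -- is `choose 0 b` with `b ≥ 1`.
    · have : (a + b - t).choose b = 0 := Nat.choose_eq_zero_of_lt (by omega)
      simp [this]
    · have g1 := tendsto_sum_mul_partialSum_add hστ hτ (Nat.add_one_ne_zero t) hge
      have g2 := (tendsto_sum_mul_partialSum_sub hστ hτ (Nat.add_one_ne_zero t)
        hge).const_mul ((-1 : ℝ) ^ (t + 1))
      simpa using (g1.add g2).const_mul ((a + b - t).choose b : ℝ)
  have h4 := ((h3.sub h1).add h2).const_mul ((-1 : ℝ) ^ (a + 1) / 2)
  simp only [mul_zero, sub_zero, add_zero] at h4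
  refine h4.congr fun N => ?_
  rw [← doublePartialSum_sub_partialFormula hσ hτ hM N]
  have hs2 : (-1 : ℝ) ^ (a + 1) * (-1) ^ (a + 1) = 1 := by rw [← mul_pow]; simp
  linear_combination (doublePartialSum σ τ (a + 1) (b + 1) N
    - partialFormula σ τ (a + 1) (b + 1) N) * hs2

/-! ### Stuffle symmetry and the case `s = 1` -/

/-- The stuffle product of two partial sums. -/
lemma doublePartialSum_add_swap (σ τ : ℝ) (r s N : ℕ) :
    doublePartialSum σ τ r s N + doublePartialSum τ σ s r N + partialSum (σ * τ) (r + s) N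
      = partialSum σ r N * partialSum τ s N := by
  unfold doublePartialSum
  induction N with
  | zero => simp [partialSum_zero]
  | succ N ih =>
    rw [sum_range_succ, sum_range_succ, partialSum_succ, partialSum_succ, partialSum_succ,
      mul_pow, pow_add _ r s]
    have : σ ^ (N + 1) * τ ^ (N + 1) / (((N : ℝ) + 1) ^ r * ((N : ℝ) + 1) ^ s)
        = σ ^ (N + 1) / ((N : ℝ) + 1) ^ r * (τ ^ (N + 1) / ((N : ℝ) + 1) ^ s) := by
      field_simp
    rw [this]
    linear_combination ih

/-- As `(-1)^s = -(-1)^r`, the sums over `l` cancel, the coefficients of the product add to `1`, and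
the two halves of the single sum cancel the added one. -/
lemma partialFormula_add_swap (σ τ : ℝ) {r s : ℕ} (h : Odd (r + s)) (N : ℕ) :
    partialFormula σ τ r s N + partialFormula τ σ s r N + partialSum (σ * τ) (r + s) N
      = partialSum σ r N * partialSum τ s N := by
  have hs : (-1 : ℝ) ^ s = -(-1) ^ r := by
    have h : (-1 : ℝ) ^ r * (-1) ^ s = -1 := by
      rw [← pow_add]; exact h.neg_one_pow
    rcases neg_one_pow_eq_or ℝ r with h1 | h1 <;> rw [h1] at h ⊢ <;> linarith
  unfold partialFormula
  rw [add_comm s r, mul_comm τ σ, hs]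
  simp only [add_comm (_ * partialSum τ _ N)]
  ring

/-- The partial sums of the double series are asymptotic to the evaluation in partial sums of
single zeta values, whether or not either of them converges. -/
theorem tendsto_doublePartialSum_sub {σ τ : ℝ} (hσ : σ = 1 ∨ σ = -1) (hτ : τ = 1 ∨ τ = -1)
    {r s : ℕ} (hr : 1 ≤ r) (hs : 1 ≤ s) (hodd : Odd (r + s)) (h3 : 3 ≤ r + s) :
    Tendsto (fun N => doublePartialSum σ τ r s N - partialFormula σ τ r s N) atTop (𝓝 0) := by
  obtain ⟨a, rfl⟩ := Nat.exists_eq_add_of_le' hr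
  obtain ⟨b, rfl⟩ := Nat.exists_eq_add_of_le' hs
  have hab : Odd (a + b) := by
    obtain ⟨M, hM⟩ := hodd
    exact ⟨M - 1, by omega⟩
  rcases Nat.eq_zero_or_pos b with hb | hb
  -- For `s = 1` the other exponent is at least `2`; the two swap relations make the difference here
  -- the negative of the swapped one.
  · have h := (tendsto_doublePartialSum_sub_of_two_le hτ hσ (a := b) (b := a)
      (by rwa [add_comm]) (by omega)).neg
    rw [neg_zero] at h
    refine h.congr fun N => ?_
    linear_combination partialFormula_add_swap σ τ hodd N
      - doublePartialSum_add_swap σ τ (a + 1) (b + 1) N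
  · exact tendsto_doublePartialSum_sub_of_two_le hσ hτ hab hb

/-! ### Passage to the limit -/

lemma tendsto_partialSum_one {k : ℕ} (hk : 2 ≤ k) :
    Tendsto (partialSum 1 k) atTop (𝓝 (zeta k)) := by
  have h : Summable fun n : ℕ => 1 / ((n : ℝ) + 1) ^ k := by
    have := (summable_nat_add_iff 1).2 (Real.summable_one_div_nat_pow.2 (show 1 < k by omega))
    exact_mod_cast this
  have h2 := h.hasSum.tendsto_sum_nat
  rw [zeta, if_neg (by omega)]
  refine h2.congr fun N => ?_
  simp [partialSum]

lemma hasSum_conditional_iff {f : ℕ → ℝ} {L : ℝ} :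
    HasSum f L (SummationFilter.conditional ℕ)
      ↔ Tendsto (fun N => ∑ n ∈ range N, f n) atTop (𝓝 L) := by
  rw [HasSum, SummationFilter.conditional_filter_eq_map_range, tendsto_map'_iff]
  rfl

lemma tendsto_partialSum_neg_one {k : ℕ} (hk : 1 ≤ k) :
    Tendsto (partialSum (-1) k) atTop (𝓝 (zetaBar k)) := by
  have hanti : Antitone fun n : ℕ => 1 / ((n : ℝ) + 1) ^ k := by
    intro m n hmn
    have : (m : ℝ) ≤ n := by exact_mod_cast hmn
    dsimp only
    gcongr
  have hlim : Tendsto (fun n : ℕ => 1 / ((n : ℝ) + 1) ^ k) atTop (𝓝 0) := by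
    have := (tendsto_one_div_add_atTop_nhds_zero_nat (𝕜 := ℝ)).pow k
    rw [zero_pow (by omega)] at this
    refine this.congr fun n => ?_
    rw [div_pow, one_pow]
  obtain ⟨L, hL⟩ := hanti.tendsto_alternating_series_of_tendsto_zero hlim
  have h : Tendsto (partialSum (-1) k) atTop (𝓝 (-L)) := by
    refine hL.neg.congr fun N => ?_
    rw [partialSum, ← sum_neg_distrib]
    refine sum_congr rfl fun n _ => ?_
    rw [pow_succ]
    ring
  rw [zetaBar, if_neg (by omega), (hasSum_conditional_iff.2 h).tsum_eq]
  exact h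

lemma tendsto_partialValue_one {k : ℕ} (hk : k ≠ 1) :
    Tendsto (partialValue 1 k) atTop (𝓝 (zeta k)) := by
  rcases Nat.eq_zero_or_pos k with rfl | h
  · rw [zeta, if_pos rfl]
    exact tendsto_const_nhds.congr fun N => (if_pos rfl).symm
  · refine (tendsto_partialSum_one (by omega)).congr fun N => ?_
    rw [partialValue, if_neg (by omega)]

lemma tendsto_partialValue_neg_one (k : ℕ) :
    Tendsto (partialValue (-1) k) atTop (𝓝 (zetaBar k)) := by
  rcases Nat.eq_zero_or_pos k with rfl | h
  · rw [zetaBar, if_pos rfl]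
    exact tendsto_const_nhds.congr fun N => (if_pos rfl).symm
  · refine (tendsto_partialSum_neg_one h).congr fun N => ?_
    rw [partialValue, if_neg (by omega)]

/-- A multiple of `ζ(i)` is a limit of partial sums if the coefficient is `0` for `i = 1`. -/
lemma tendsto_mul_partialSum_one {c : ℝ} {i : ℕ} (hi : i ≠ 0) (hc : i = 1 → c = 0) :
    Tendsto (fun N => c * partialSum 1 i N) atTop (𝓝 (c * zeta i)) := by
  by_cases h : i = 1
  · simp [hc h]
  · exact (tendsto_partialSum_one (by omega)).const_mul c

lemma sum_Icc_one_eq_sum_range (g : ℕ → ℝ) (n : ℕ) :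
    ∑ j ∈ Icc 1 n, g j = ∑ j ∈ range n, g (j + 1) := by
  induction n with
  | zero => simp
  | succ n ih => rw [sum_Icc_succ_top (by omega), ih, sum_range_succ]

/-- A double series converges to the limit of the evaluation in partial sums. -/
lemma converges_and_seriesSum_eq {σ τ : ℝ} (hσ : σ = 1 ∨ σ = -1) (hτ : τ = 1 ∨ τ = -1)
    {r s : ℕ} (hr : 1 ≤ r) (hs : 1 ≤ s) (hodd : Odd (r + s)) (h3 : 3 ≤ r + s) {f : ℕ → ℝ}
    (hf : ∀ m, f m = τ ^ m / (m : ℝ) ^ s * ∑ j ∈ Icc 1 (m - 1), σ ^ j / (j : ℝ) ^ r) {L : ℝ}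
    (hL : Tendsto (partialFormula σ τ r s) atTop (𝓝 L)) :
    Converges f ∧ seriesSum f = L := by
  have h := (tendsto_doublePartialSum_sub hσ hτ hr hs hodd h3).add hL
  simp only [sub_add_cancel, zero_add] at h
  have h' : HasSum (fun n => f (n + 2)) L (SummationFilter.conditional ℕ) := by
    rw [hasSum_conditional_iff]
    refine (h.comp (tendsto_add_atTop_nat 1)).congr fun N => ?_
    simp only [Function.comp_apply]
    -- The term of index `1` has an empty inner sum, so starting at `2` loses nothing.
    rw [doublePartialSum, sum_range_succ', partialSum_zero, mul_zero, add_zero]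
    refine sum_congr rfl fun n _ => ?_
    rw [hf, sum_Icc_one_eq_sum_range, partialSum]
    push_cast
    have e : (n : ℝ) + 1 + 1 = n + 2 := by ring
    rw [e]
  exact ⟨h'.summable, h'.tsum_eq⟩

lemma tendsto_partialFormula_barLeft {r s : ℕ} (hr : 1 ≤ r) (hs : 2 ≤ s) (hodd : Odd (r + s)) :
    Tendsto (partialFormula (-1) 1 r s) atTop (𝓝 (-(1 / 2) * zetaBar (r + s)
        + (1 + (-1 : ℝ) ^ s) / 2 * (zetaBar r * zeta s)
        + (-1 : ℝ) ^ r * ∑ l ∈ Icc 0 ((r + s - 1) / 2),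
            (((r + s - 2 * l - 1).choose (r - 1) : ℝ) * zetaBar (r + s - 2 * l)
              + ((r + s - 2 * l - 1).choose (s - 1) : ℝ) * zeta (r + s - 2 * l))
            * zetaBar (2 * l))) := by
  unfold partialFormula
  rw [show (-1 : ℝ) * 1 = -1 by norm_num]
  obtain ⟨M, hM⟩ := hodd
  refine (((tendsto_partialSum_neg_one (by omega)).const_mul _).add
    (((tendsto_partialSum_neg_one hr).mul (tendsto_partialSum_one hs)).const_mul _)).add
    ((tendsto_finsetSum _ fun l hl => ?_).const_mul _)
  have hl := (mem_Icc.1 hl).2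
  refine (((tendsto_partialSum_neg_one (by omega)).const_mul _).add
    (tendsto_mul_partialSum_one (by omega) fun h => ?_)).mul (tendsto_partialValue_neg_one _)
  -- Argument `1` forces `2l = r + s - 1`, so the coefficient is `choose 0 (s - 1)` with `s ≥ 2`.
  rw [Nat.choose_eq_zero_of_lt (by omega), Nat.cast_zero]

lemma tendsto_partialFormula_barRight {r s : ℕ} (hr : 2 ≤ r) (hs : 1 ≤ s) (hodd : Odd (r + s)) :
    Tendsto (partialFormula 1 (-1) r s) atTop (𝓝 (-(1 / 2) * zetaBar (r + s)
        + (1 + (-1 : ℝ) ^ s) / 2 * (zeta r * zetaBar s)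
        + (-1 : ℝ) ^ r * ∑ l ∈ Icc 0 ((r + s - 1) / 2),
            (((r + s - 2 * l - 1).choose (r - 1) : ℝ) * zeta (r + s - 2 * l)
              + ((r + s - 2 * l - 1).choose (s - 1) : ℝ) * zetaBar (r + s - 2 * l))
            * zetaBar (2 * l))) := by
  unfold partialFormula
  rw [show 1 * (-1 : ℝ) = -1 by norm_num]
  obtain ⟨M, hM⟩ := hodd
  refine (((tendsto_partialSum_neg_one (by omega)).const_mul _).add
    (((tendsto_partialSum_one hr).mul (tendsto_partialSum_neg_one hs)).const_mul _)).add
    ((tendsto_finsetSum _ fun l hl => ?_).const_mul _)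
  have hl := (mem_Icc.1 hl).2
  refine ((tendsto_mul_partialSum_one (by omega) fun h => ?_).add
    ((tendsto_partialSum_neg_one (by omega)).const_mul _)).mul (tendsto_partialValue_neg_one _)
  rw [Nat.choose_eq_zero_of_lt (by omega), Nat.cast_zero]

/-- For `r = 1` the two products with partial sums of the harmonic series cancel. -/
lemma tendsto_partialFormula_one_barRight {s : ℕ} (hs : 2 ≤ s) (hodd : Odd (1 + s)) :
    Tendsto (partialFormula 1 (-1) 1 s) atTop (𝓝 (-(1 / 2) * zetaBar (1 + s)
        + (-1 : ℝ) ^ 1 *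
          (∑ l ∈ Icc 0 ((1 + s - 3) / 2),
              ((1 + s - 2 * l - 1).choose (1 - 1) : ℝ) * zeta (1 + s - 2 * l) * zetaBar (2 * l)
            + ∑ l ∈ Icc 0 ((1 + s - 1) / 2),
              ((1 + s - 2 * l - 1).choose (s - 1) : ℝ) * zetaBar (1 + s - 2 * l)
                * zetaBar (2 * l)))) := by
  obtain ⟨M, hM⟩ := hodd
  have hs' : s = 2 * M := by omega
  have h1 : (1 + s - 1) / 2 = (1 + s - 3) / 2 + 1 := by omega
  have key : ∀ N, -(1 / 2) * partialSum (-1) (1 + s) N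
        + (-1 : ℝ) ^ 1 *
          (∑ l ∈ Icc 0 ((1 + s - 3) / 2), ((1 + s - 2 * l - 1).choose (1 - 1) : ℝ)
              * partialSum 1 (1 + s - 2 * l) N * partialValue (-1) (2 * l) N
            + ∑ l ∈ Icc 0 ((1 + s - 1) / 2), ((1 + s - 2 * l - 1).choose (s - 1) : ℝ)
              * partialSum (-1) (1 + s - 2 * l) N * partialValue (-1) (2 * l) N)
      = partialFormula 1 (-1) 1 s N := by
    intro N
    -- The summand `2l = s` carries the harmonic sum. Since `s` is even, the product in
    -- `partialFormula` has coefficient `1`, and the sign `(-1)^1` makes the two cancel.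
    have e : ∑ l ∈ Icc 0 ((1 + s - 1) / 2), ((1 + s - 2 * l - 1).choose (1 - 1) : ℝ)
          * partialSum 1 (1 + s - 2 * l) N * partialValue (-1) (2 * l) N
        = ∑ l ∈ Icc 0 ((1 + s - 3) / 2), ((1 + s - 2 * l - 1).choose (1 - 1) : ℝ)
          * partialSum 1 (1 + s - 2 * l) N * partialValue (-1) (2 * l) N
          + partialSum 1 1 N * partialSum (-1) s N := by
      rw [h1, sum_Icc_succ_top (by omega)]
      have h2 : 2 * ((1 + s - 3) / 2 + 1) = s := by omega
      have h3 : 1 + s - s = 1 := by omega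
      rw [h2, h3, partialValue, if_neg (by omega)]
      simp
    have hpow : (-1 : ℝ) ^ s = 1 := by rw [hs']; simp
    unfold partialFormula
    rw [hpow, show 1 * (-1 : ℝ) = -1 by norm_num]
    simp only [add_mul, sum_add_distrib]
    rw [e]
    ring
  refine Tendsto.congr key ?_
  refine ((tendsto_partialSum_neg_one (by omega)).const_mul _).add
    (((tendsto_finsetSum _ fun l hl => ?_).add (tendsto_finsetSum _ fun l hl => ?_)).const_mul _)
  · have hl := (mem_Icc.1 hl).2
    exact ((tendsto_partialSum_one (by omega)).const_mul _).mul (tendsto_partialValue_neg_one _)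
  · have hl := (mem_Icc.1 hl).2
    exact ((tendsto_partialSum_neg_one (by omega)).const_mul _).mul
      (tendsto_partialValue_neg_one _)

/-- No `ζ(1)` arises: non-alternating values occur only at even arguments and at the weight, and the
alternating ones converge at `1`. -/
lemma tendsto_partialFormula_barBoth {r s : ℕ} (hr : 1 ≤ r) (hs : 1 ≤ s) (hodd : Odd (r + s))
    (h3 : 3 ≤ r + s) :
    Tendsto (partialFormula (-1) (-1) r s) atTop (𝓝 (-(1 / 2) * zeta (r + s)
        + (1 + (-1 : ℝ) ^ s) / 2 * (zetaBar r * zetaBar s)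
        + (-1 : ℝ) ^ r * ∑ l ∈ Icc 0 ((r + s - 1) / 2),
            (((r + s - 2 * l - 1).choose (r - 1) : ℝ) * zetaBar (r + s - 2 * l)
              + ((r + s - 2 * l - 1).choose (s - 1) : ℝ) * zetaBar (r + s - 2 * l))
            * zeta (2 * l))) := by
  unfold partialFormula
  rw [show -1 * (-1 : ℝ) = 1 by norm_num]
  obtain ⟨M, hM⟩ := hodd
  refine (((tendsto_partialSum_one (by omega)).const_mul _).add
    (((tendsto_partialSum_neg_one hr).mul (tendsto_partialSum_neg_one hs)).const_mul _)).add
    ((tendsto_finsetSum _ fun l hl => ?_).const_mul _)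
  have hl := (mem_Icc.1 hl).2
  exact (((tendsto_partialSum_neg_one (by omega)).const_mul _).add
    ((tendsto_partialSum_neg_one (by omega)).const_mul _)).mul
    (tendsto_partialValue_one (by omega))

end DoubleEuler

/-- The formulas for `ζ(r̄, s)`, `ζ(r, s̄)` and `ζ(r̄, s̄)` with `k = r + s ≥ 3` odd. The first
needs `s ≥ 2` (otherwise its series diverges); the second is given for `r ≥ 2`, and for `r = 1` in
the form from which the two cancelling products with the divergent `ζ(1)` are removed. Wherever
`zeta 1` is still written, its binomial coefficient `choose 0 (s - 1)` or `choose 0 (r - 1)` is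
zero. -/
theorem theorem2p9 (r s k : ℕ) (hr : 1 ≤ r) (hs : 1 ≤ s) (hk : k = r + s) (hk3 : 3 ≤ k)
    (hodd : Odd k) :
    (2 ≤ s →
      DoubleEuler.Converges (DoubleEuler.termBarLeft r s) ∧
      DoubleEuler.zetaBarLeft r s =
        -(1 / 2) * DoubleEuler.zetaBar k
        + (1 + (-1 : ℝ) ^ s) / 2 * (DoubleEuler.zetaBar r * DoubleEuler.zeta s)
        + (-1 : ℝ) ^ r * ∑ l ∈ Finset.Icc 0 ((k - 1) / 2),
            (((k - 2 * l - 1).choose (r - 1) : ℝ) * DoubleEuler.zetaBar (k - 2 * l)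
              + ((k - 2 * l - 1).choose (s - 1) : ℝ) * DoubleEuler.zeta (k - 2 * l))
            * DoubleEuler.zetaBar (2 * l)) ∧
    (2 ≤ r →
      DoubleEuler.Converges (DoubleEuler.termBarRight r s) ∧
      DoubleEuler.zetaBarRight r s =
        -(1 / 2) * DoubleEuler.zetaBar k
        + (1 + (-1 : ℝ) ^ s) / 2 * (DoubleEuler.zeta r * DoubleEuler.zetaBar s)
        + (-1 : ℝ) ^ r * ∑ l ∈ Finset.Icc 0 ((k - 1) / 2),
            (((k - 2 * l - 1).choose (r - 1) : ℝ) * DoubleEuler.zeta (k - 2 * l)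
              + ((k - 2 * l - 1).choose (s - 1) : ℝ) * DoubleEuler.zetaBar (k - 2 * l))
            * DoubleEuler.zetaBar (2 * l)) ∧
    (r = 1 →
      DoubleEuler.Converges (DoubleEuler.termBarRight r s) ∧
      DoubleEuler.zetaBarRight r s =
        -(1 / 2) * DoubleEuler.zetaBar k
        + (-1 : ℝ) ^ r *
          (∑ l ∈ Finset.Icc 0 ((k - 3) / 2),
              ((k - 2 * l - 1).choose (r - 1) : ℝ) * DoubleEuler.zeta (k - 2 * l)
                * DoubleEuler.zetaBar (2 * l)
            + ∑ l ∈ Finset.Icc 0 ((k - 1) / 2),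
              ((k - 2 * l - 1).choose (s - 1) : ℝ) * DoubleEuler.zetaBar (k - 2 * l)
                * DoubleEuler.zetaBar (2 * l))) ∧
    (DoubleEuler.Converges (DoubleEuler.termBarBoth r s) ∧
      DoubleEuler.zetaBarBoth r s =
        -(1 / 2) * DoubleEuler.zeta k
        + (1 + (-1 : ℝ) ^ s) / 2 * (DoubleEuler.zetaBar r * DoubleEuler.zetaBar s)
        + (-1 : ℝ) ^ r * ∑ l ∈ Finset.Icc 0 ((k - 1) / 2),
            (((k - 2 * l - 1).choose (r - 1) : ℝ) * DoubleEuler.zetaBar (k - 2 * l)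
              + ((k - 2 * l - 1).choose (s - 1) : ℝ) * DoubleEuler.zetaBar (k - 2 * l))
            * DoubleEuler.zeta (2 * l)) := by
  subst hk
  refine ⟨fun h => ?_, fun h => ?_, fun h => ?_, ?_⟩
  · exact DoubleEuler.converges_and_seriesSum_eq (.inr rfl) (.inl rfl) hr hs hodd hk3
      (fun m => by rw [DoubleEuler.termBarLeft, one_pow])
      (DoubleEuler.tendsto_partialFormula_barLeft hr h hodd)
  · exact DoubleEuler.converges_and_seriesSum_eq (.inl rfl) (.inr rfl) hr hs hodd hk3
      (fun m => by simp only [DoubleEuler.termBarRight, one_pow])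
      (DoubleEuler.tendsto_partialFormula_barRight h hs hodd)
  · subst h
    exact DoubleEuler.converges_and_seriesSum_eq (.inl rfl) (.inr rfl) hr hs hodd hk3
      (fun m => by simp only [DoubleEuler.termBarRight, one_pow])
      (DoubleEuler.tendsto_partialFormula_one_barRight (by omega) hodd)
  · exact DoubleEuler.converges_and_seriesSum_eq (.inr rfl) (.inr rfl) hr hs hodd hk3
      (fun _ => rfl) (DoubleEuler.tendsto_partialFormula_barBoth hr hs hodd hk3)
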